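/- Let $G$ be a finite labeled multigraph with $p\ge 2$ vertices; that is, $G$ has finitely many vertices, enumerated $v_1,\dots,v_p$, and finitely many edges, each joining two distinct vertices, where several (parallel) edges may join the same pair of vertices. Let $A'$ be its Kirchhoff (Laplacian) matrix: the $p\times p$ matrix whose diagonal entry $a'_{i,i}$ is the degree of $v_i$ and whose entry $a'_{i,j}$, for $i\ne j$, is minus the number of edges between $v_i$ and $v_j$. Let $M$ be the Kirchhoff minor of $G$: the $(p-1)\times(p-1)$ matrix obtained from $A'$ by deleting its last row and its last column. Then $$s(G)=\det M,$$ where $s(G)$ denotes the number of spanning trees of $G$, that is, of the subgraphs of $G$ that contain all vertices of $G$, are connected and have no cycles (two subgraphs that use different edges are counted as different, even if these edges are parallel). -/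

import Mathlib

namespace Graph

/-- A (multi)graph is connected if it has a vertex and any two of its vertices are joined by a
walk, that is, by a finite chain of successively adjacent vertices. -/
def IsConnected {α β : Type*} (G : Graph α β) : Prop :=
  G.vertexSet.Nonempty ∧
    ∀ x ∈ G.vertexSet, ∀ y ∈ G.vertexSet, Relation.ReflTransGen G.Adj x y

/-- `G.IsCycle v e` says that the vertices `v 0, …, v n` and the edges `e 0, …, e n` form a cycle
of length `n + 1` in `G`: the vertices are pairwise distinct, the edges are pairwise distinct, and
`e i` joins `v i` to the cyclically next vertex (addition in `Fin (n + 1)` is modulo `n + 1`).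
A loop is a cycle of length one, and a pair of parallel edges forms a cycle of length two. -/
def IsCycle {α β : Type*} (G : Graph α β) {n : ℕ}
    (v : Fin (n + 1) → α) (e : Fin (n + 1) → β) : Prop :=
  Function.Injective v ∧ Function.Injective e ∧ ∀ i, G.IsLink (e i) (v i) (v (i + 1))

/-- A graph is acyclic if it contains no cycle of any length. -/
def IsAcyclic {α β : Type*} (G : Graph α β) : Prop :=
  ∀ (n : ℕ) (v : Fin (n + 1) → α) (e : Fin (n + 1) → β), ¬ G.IsCycle v e

/-- A tree is a connected graph without cycles. -/
def IsTree {α β : Type*} (G : Graph α β) : Prop :=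
  G.IsConnected ∧ G.IsAcyclic

/-- The number `s(G)` of spanning trees of `G`: the number of subgraphs of `G` that contain all
vertices of `G` and are trees. Subgraphs with different edge sets are different, also when the
edges in which they differ are parallel. -/
noncomputable def numSpanningTrees {α β : Type*} (G : Graph α β) : ℕ :=
  {T : Graph α β | T.IsSpanningSubgraph G ∧ T.IsTree}.ncard

/-- The degree of a vertex: the number of edges incident with it, where loops count twice. -/
noncomputable def degree {α β : Type*} (G : Graph α β) (x : α) : ℕ :=
  (G.incidenceSet x).ncard + (G.loopSet x).ncard

/-- The adjacency matrix of `G`, for the enumeration `v` of its vertices: the entry at `(i, j)` is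
the number of edges between the `i`-th and the `j`-th vertex. -/
noncomputable def adjacencyMatrix {α β : Type*} (G : Graph α β) {p : ℕ}
    (v : Fin p ≃ G.vertexSet) : Matrix (Fin p) (Fin p) ℤ :=
  Matrix.of fun i j => ({e : β | G.IsLink e (v i) (v j)}.ncard : ℤ)

/-- The Kirchhoff (Laplacian) matrix of `G`, for the enumeration `v` of its vertices: the negated
adjacency matrix with the diagonal replaced by the degrees of the vertices. -/
noncomputable def kirchhoffMatrix {α β : Type*} (G : Graph α β) {p : ℕ}
    (v : Fin p ≃ G.vertexSet) : Matrix (Fin p) (Fin p) ℤ :=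
  Matrix.of fun i j => if i = j then (G.degree (v i) : ℤ) else -G.adjacencyMatrix v i j

/-- The Kirchhoff minor: the Kirchhoff matrix with its last row and last column deleted. -/
noncomputable def kirchhoffMinor {α β : Type*} (G : Graph α β) {p : ℕ}
    (v : Fin p ≃ G.vertexSet) : Matrix (Fin (p - 1)) (Fin (p - 1)) ℤ :=
  (G.kirchhoffMatrix v).submatrix (Fin.castLE (Nat.sub_le p 1)) (Fin.castLE (Nat.sub_le p 1))

end Graph

/-! ### Determinants of self-maps rooted at the last point -/

namespace Matrix

/-! Take the last vertex as root. Row `i` of the minor is a sum, over the edges at vertex `i`, of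
the unit row at `i` minus the unit row at the other end (zero if that end is the root).
Multilinearity turns the determinant into a sum over choices of one edge per non-root vertex
(`det_kirchhoffMinor`). A choice contributes 1 if following its edges always leads to the root, and
0 otherwise. The choices of the first kind correspond to spanning trees, all edges pointing towards
the root (`numSpanningTrees_eq_card`). -/

/-- A self-map of `{0, …, n}` fixing `n`, given by its values on the remaining points, is rooted if
it strictly decreases some height function away from `n`. -/
def IsRooted {n : ℕ} (g : Fin n → Fin (n + 1)) : Prop :=
  ∃ d : Fin (n + 1) → ℕ, ∀ i, d (g i) < d i.castSucc

lemma isRooted_of_forall_iterate {n : ℕ} {g : Fin n → Fin (n + 1)} {h : Fin (n + 1) → Fin (n + 1)}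
    (hg : ∀ i : Fin n, h i.castSucc = g i) (H : ∀ x, ∃ k, h^[k] x = Fin.last n) : IsRooted g := by
  classical
  refine ⟨fun x => Nat.find (H x), fun i => ?_⟩
  have h1 := Nat.find_spec (H i.castSucc)
  dsimp only
  cases hk : Nat.find (H i.castSucc) with
  | zero =>
    rw [hk] at h1
    exact absurd h1 (Fin.castSucc_lt_last i).ne
  | succ k =>
    rw [hk, Function.iterate_succ_apply, hg] at h1
    exact Nat.lt_succ_of_le (Nat.find_min' (H (g i)) h1)

/-- The identity matrix minus the transition matrix of `g`, without the row and column of the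
last point. -/
def transitionLaplacian {n : ℕ} (g : Fin n → Fin (n + 1)) : Matrix (Fin n) (Fin n) ℤ :=
  of fun i k => (if i = k then 1 else 0) - (if g i = k.castSucc then 1 else 0)

/-- Sorted by height, the matrix is block triangular. Its diagonal blocks are identities, since `g`
never preserves height. -/
lemma det_transitionLaplacian_of_isRooted {n : ℕ} {g : Fin n → Fin (n + 1)} (hg : IsRooted g) :
    (transitionLaplacian g).det = 1 := by
  obtain ⟨d, hd⟩ := hg
  have hT : (transitionLaplacian g).BlockTriangular fun i => OrderDual.toDual (d i.castSucc) := by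
    intro i k hik
    have hik : d i.castSucc < d k.castSucc := hik
    have h1 : i ≠ k := by rintro rfl; exact lt_irrefl _ hik
    have h2 : g i ≠ k.castSucc := by
      intro h
      have := hd i
      rw [h] at this
      omega
    simp [transitionLaplacian, h1, h2]
  rw [hT.det]
  refine Finset.prod_eq_one fun a _ => ?_
  suffices h1 : (transitionLaplacian g).toSquareBlock
      (fun i => OrderDual.toDual (d i.castSucc)) a = 1 by rw [h1, det_one]
  ext ⟨i, hi⟩ ⟨k, hk⟩
  have h2 : g i ≠ k.castSucc := by
    intro h
    have := hd i
    rw [h] at this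
    have : d i.castSucc = d k.castSucc := OrderDual.toDual.injective (hi.trans hk.symm)
    omega
  simp [transitionLaplacian, toSquareBlock_def, h2, one_apply]

/-- The indicator of the points whose orbit misses the root is invariant and nonzero, so it lies in
the kernel. -/
lemma det_transitionLaplacian_of_not_isRooted {n : ℕ} {g : Fin n → Fin (n + 1)}
    (hg : ¬ IsRooted g) : (transitionLaplacian g).det = 0 := by
  classical
  let h : Fin (n + 1) → Fin (n + 1) := Fin.lastCases (Fin.last n) g
  have hc : ∀ i : Fin n, h i.castSucc = g i := fun i => by simp [h]
  have hl : h (Fin.last n) = Fin.last n := by simp [h]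
  let u : Fin (n + 1) → ℤ := fun x => if ∃ k, h^[k] x = Fin.last n then 0 else 1
  have hul : u (Fin.last n) = 0 := if_pos ⟨0, rfl⟩
  have hu : ∀ x, u (h x) = u x := by
    intro x
    have : (∃ k, h^[k] (h x) = Fin.last n) ↔ ∃ k, h^[k] x = Fin.last n := by
      constructor
      · rintro ⟨k, hk⟩
        exact ⟨k + 1, hk⟩
      · rintro ⟨k, hk⟩
        refine ⟨k, ?_⟩
        rw [← Function.iterate_succ_apply, Function.iterate_succ_apply', hk, hl]
    simp only [u, this]
  rw [← exists_mulVec_eq_zero_iff]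
  refine ⟨fun i => u i.castSucc, fun h0 => hg (isRooted_of_forall_iterate hc fun x => ?_), ?_⟩
  · induction x using Fin.lastCases with
    | last => exact ⟨0, rfl⟩
    | cast i =>
      by_contra hx
      have := congrFun h0 i
      simp [u, hx] at this
  · ext i
    -- The missing column does no harm because `u` vanishes at the last point.
    have hs : ∑ k : Fin n, (if g i = k.castSucc then u k.castSucc else 0) = u (g i) := by
      have := Fin.sum_univ_castSucc fun x : Fin (n + 1) => if g i = x then u x else 0
      rw [Finset.sum_ite_eq, if_pos (Finset.mem_univ _)] at this
      rw [this, hul, ite_self, add_zero]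
    simp only [mulVec, dotProduct, transitionLaplacian, of_apply, sub_mul, ite_mul, one_mul,
      zero_mul, Finset.sum_sub_distrib, hs, Finset.sum_ite_eq, Finset.mem_univ, if_true,
      Pi.zero_apply]
    rw [← hc, hu, sub_self]

end Matrix

/-! ### Trees and height functions -/

namespace Graph

open Relation

variable {α β : Type*}

/-- A highest vertex of a cycle would have both its cycle edges going down, so they coincide. -/
lemma isAcyclic_of_height {T : Graph α β} (d : α → ℕ)
    (hne : ∀ e x y, T.IsLink e x y → d x ≠ d y)
    (hf : ∀ e e' x y y', T.IsLink e x y → T.IsLink e' x y' → d y < d x → d y' < d x → e = e') : T.IsAcyclic := by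
  rintro n v e ⟨-, he, hl⟩
  obtain ⟨i, hi⟩ := Finite.exists_max fun i => d (v i)
  have h1 := hl i
  have h2 := hl (i - 1)
  rw [sub_add_cancel] at h2
  have h3 : i = i - 1 := he (hf _ _ _ _ _ h1 h2.symm
    (lt_of_le_of_ne (hi _) (hne _ _ _ h1).symm) (lt_of_le_of_ne (hi _) (hne _ _ _ h2)))
  -- Now `i + 1 = i`: the cycle is a loop, which `hne` excludes.
  rw [eq_sub_iff_add_eq] at h3
  rw [h3] at h1
  exact hne _ _ _ h1 rfl

lemma isConnected_of_height {T : Graph α β} (d : α → ℕ) {r : α} (hr : r ∈ T.vertexSet)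
    (hd : ∀ x ∈ T.vertexSet, x ≠ r → ∃ y, T.Adj x y ∧ d y < d x) : T.IsConnected := by
  have key : ∀ (k : ℕ), ∀ x ∈ T.vertexSet, d x = k → ReflTransGen T.Adj x r := by
    intro k
    induction k using Nat.strong_induction_on with
    | _ k ih =>
      intro x hx hk
      by_cases hxr : x = r
      · rw [hxr]
      · obtain ⟨y, hxy, hlt⟩ := hd x hx hxr
        exact ReflTransGen.head hxy (ih _ (hk ▸ hlt) y hxy.right_mem rfl)
  exact ⟨⟨r, hr⟩, fun x hx y hy => (key _ x hx rfl).trans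
    (ReflTransGen.stdSymm.symm _ _ (key _ y hy rfl))⟩

/-- The simple graph obtained from a multigraph by forgetting loops and edge multiplicities. -/
def toSimple (T : Graph α β) : SimpleGraph α where
  Adj x y := x ≠ y ∧ T.Adj x y
  symm := ⟨fun _ _ h => ⟨h.1.symm, h.2.symm⟩⟩
  loopless := ⟨fun _ h => h.1 rfl⟩

lemma reachable_toSimple {T : Graph α β} {x y : α} (h : ReflTransGen T.Adj x y) :
    T.toSimple.Reachable x y := by
  induction h with
  | refl => rfl
  | @tail b c _ hbc ih =>
    by_cases h : b = c
    · exact h ▸ ih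
    · exact ih.trans (SimpleGraph.Adj.reachable ⟨h, hbc⟩)

/-- The height is the distance to `r`; the first edge of a shortest walk descends. -/
lemma IsConnected.exists_height {T : Graph α β} (hT : T.IsConnected) {r : α}
    (hr : r ∈ T.vertexSet) :
    ∃ d : α → ℕ, ∀ x ∈ T.vertexSet, x ≠ r → ∃ e y, T.IsLink e x y ∧ d y < d x := by
  refine ⟨fun x => T.toSimple.dist x r, fun x hx hxr => ?_⟩
  obtain ⟨p, hp⟩ := (reachable_toSimple (hT.2 x hx r hr)).exists_walk_length_eq_dist
  cases p with
  | nil => exact absurd rfl hxr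
  | cons h q =>
    obtain ⟨e, he⟩ := h.2
    refine ⟨e, _, he, ?_⟩
    have := SimpleGraph.dist_le q
    rw [SimpleGraph.Walk.length_cons] at hp
    dsimp only
    omega

/-- An edge outside `F` would close a path with edges in `F` to a cycle. -/
lemma IsAcyclic.edgeSet_subset {T : Graph α β} (hT : T.IsAcyclic) {F : Set β}
    (hF : (T.restrict F).IsConnected) : T.edgeSet ⊆ F := by
  intro e₀ he₀
  by_contra hne
  obtain ⟨x, y, hxy⟩ := T.exists_isLink_of_mem_edgeSet he₀
  obtain ⟨p, hp⟩ := (reachable_toSimple (hF.2 x hxy.left_mem y hxy.right_mem)).exists_isPath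
  have hadj : ∀ i, i < p.length → ∃ e ∈ F, T.IsLink e (p.getVert i) (p.getVert (i + 1)) :=
    fun i hi => (p.adj_getVert_succ hi).2
  have : Nonempty β := ⟨e₀⟩
  choose! f hfF hf using hadj
  have hinj := hp.getVert_injOn
  -- The last index carries the closing edge `e₀`; if `e₀` is a loop, the path is trivial and the
  -- cycle has length one.
  refine hT p.length (fun i => p.getVert i) (fun i => if i.1 < p.length then f i else e₀)
    ⟨fun i j hij => Fin.ext (hinj (Nat.lt_succ_iff.1 i.2) (Nat.lt_succ_iff.1 j.2) hij), ?_, ?_⟩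
  · intro i j hij
    have hi := i.2
    have hj := j.2
    dsimp only at hij
    split_ifs at hij with h1 h2 h2
    · have l1 := hf i h1
      have l2 := hf j h2
      rw [hij] at l1
      ext
      rcases l1.eq_and_eq_or_eq_and_eq l2 with ⟨h, -⟩ | ⟨h, h'⟩
      · exact hinj h1.le h2.le h
      · have a := hinj (x₁ := i) (x₂ := j + 1) h1.le h2 h
        have b := hinj (x₁ := i + 1) (x₂ := j) h1 h2.le h'
        omega
    · exact absurd (hij ▸ hfF i h1) hne
    · exact absurd (hij ▸ hfF j h2) hne
    · ext; omega
  · intro i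
    dsimp only
    split_ifs with h
    · rw [Fin.val_add_one_of_lt (by rw [Fin.lt_def]; exact h)]
      exact hf i h
    · have hi : i = Fin.last p.length := by
        ext
        have := i.2
        rw [Fin.val_last]
        omega
      subst hi
      simpa using hxy.symm

/-! ### Rooted edge choices and spanning trees -/

/-- The choices of an edge at each vertex but the last one, each recorded with its other end. -/
def IsEdgeChoice (G : Graph α β) {n : ℕ} (w : Fin (n + 1) → α) (r : Fin n → β × Fin (n + 1)) :
    Prop :=
  ∀ i, G.IsLink (r i).1 (w i.castSucc) (w (r i).2)

section EdgeChoice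

variable {G : Graph α β} {n : ℕ} {w : Fin (n + 1) → α}

lemma IsEdgeChoice.isTree {r : Fin n → β × Fin (n + 1)} (hr : G.IsEdgeChoice w r)
    (hw : Function.Injective w) (hV : Set.range w = G.vertexSet)
    (hroot : Matrix.IsRooted fun i => (r i).2) :
    (G.restrict (Set.range fun i => (r i).1)).IsTree := by
  obtain ⟨d, hd⟩ := hroot
  have hdw : ∀ x, Function.extend w d 0 (w x) = d x := hw.extend_apply d 0
  have key : ∀ e x y, (G.restrict (Set.range fun i => (r i).1)).IsLink e x y → ∃ i,
      e = (r i).1 ∧ (x = w i.castSucc ∧ y = w (r i).2 ∨ x = w (r i).2 ∧ y = w i.castSucc) := by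
    rintro e x y ⟨⟨i, rfl⟩, h⟩
    exact ⟨i, rfl, h.eq_and_eq_or_eq_and_eq (hr i)⟩
  constructor
  · refine isConnected_of_height (Function.extend w d 0) (r := w (Fin.last n))
      (hV ▸ Set.mem_range_self _) fun x hx hxr => ?_
    obtain ⟨i, rfl⟩ : x ∈ Set.range w := hV ▸ hx
    induction i using Fin.lastCases with
    | last => exact absurd rfl hxr
    | cast i =>
      refine ⟨w (r i).2, ⟨_, ⟨i, rfl⟩, hr i⟩, ?_⟩
      rw [hdw, hdw]
      exact hd i
  · refine isAcyclic_of_height (Function.extend w d 0) ?_ ?_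
    · intro e x y h
      obtain ⟨i, -, ⟨rfl, rfl⟩ | ⟨rfl, rfl⟩⟩ := key e x y h <;> rw [hdw, hdw]
      · exact (hd i).ne'
      · exact (hd i).ne
    · have up : ∀ e x y, (G.restrict (Set.range fun i => (r i).1)).IsLink e x y →
          Function.extend w d 0 y < Function.extend w d 0 x →
          ∃ i, e = (r i).1 ∧ x = w i.castSucc := by
        intro e x y h hlt
        obtain ⟨i, rfl, ⟨rfl, rfl⟩ | ⟨rfl, rfl⟩⟩ := key e x y h
        · exact ⟨i, rfl, rfl⟩
        · rw [hdw, hdw] at hlt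
          exact absurd hlt (hd i).not_gt
      intro e e' x y y' h h' hlt hlt'
      obtain ⟨i, rfl, rfl⟩ := up e x y h hlt
      obtain ⟨j, rfl, hj⟩ := up e' _ y' h' hlt'
      rw [Fin.castSucc_injective n (hw hj)]

/-- Induction on the height for `s`. The edge `s` picks at `i` is picked by `r` at some `j`. If `j`
is not `i`, it is the lower end, where `r` and `s` agree by induction; then `s` would lead from `j`
back up to `i`. -/
lemma IsEdgeChoice.eq_of_range_eq {r s : Fin n → β × Fin (n + 1)}
    (hw : Function.Injective w) (hr : G.IsEdgeChoice w r) (hs : G.IsEdgeChoice w s)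
    (hrr : Matrix.IsRooted fun i => (r i).2) (hsr : Matrix.IsRooted fun i => (s i).2)
    (h : Set.range (fun i => (r i).1) = Set.range fun i => (s i).1) : r = s := by
  obtain ⟨d, hd⟩ := hrr
  obtain ⟨d', hd'⟩ := hsr
  have key : ∀ k, ∀ i : Fin n, d' i.castSucc = k → (r i).1 = (s i).1 := by
    intro k
    induction k using Nat.strong_induction_on with
    | _ k ih =>
      intro i hi
      obtain ⟨j, hj⟩ : (s i).1 ∈ Set.range fun i => (r i).1 := h ▸ Set.mem_range_self i
      have hj : (r j).1 = (s i).1 := hj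
      have l1 := hr j
      rw [hj] at l1
      rcases l1.eq_and_eq_or_eq_and_eq (hs i) with ⟨e1, -⟩ | ⟨e1, e2⟩
      · rw [← Fin.castSucc_injective n (hw e1), hj, ← Fin.castSucc_injective n (hw e1)]
      · have e1 := hw e1
        have e2 := hw e2
        have hlt := hd' i
        have h1 := ih (d' j.castSucc) (by rw [← hi, e1]; exact hlt) j rfl
        have l2 := hs j
        rw [← h1, hj] at l2
        have e3 := hw (l2.right_unique (e1 ▸ (hs i).symm))
        have := hd' j
        dsimp only at this hlt
        rw [e3] at this
        rw [e1] at this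
        omega
  funext i
  have h1 := key _ i rfl
  have l := hs i
  rw [← h1] at l
  exact Prod.ext h1 (hw ((hr i).right_unique l))

/-- Each non-root vertex picks an edge that descends towards the root. The picked edges already
connect everything, so by acyclicity they exhaust `T`. -/
lemma IsTree.exists_isEdgeChoice {T : Graph α β} (hT : T.IsTree) (hTG : T.IsSpanningSubgraph G)
    (hw : Function.Injective w) (hV : Set.range w = G.vertexSet) :
    ∃ r : Fin n → β × Fin (n + 1), G.IsEdgeChoice w r ∧ (Matrix.IsRooted fun i => (r i).2) ∧
      G.restrict (Set.range fun i => (r i).1) = T := by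
  rw [← hTG.vertexSet_eq] at hV
  have hwT : ∀ i, w i ∈ T.vertexSet := fun i => hV ▸ Set.mem_range_self i
  obtain ⟨d, hd⟩ := hT.1.exists_height (hwT (Fin.last n))
  have hd' : ∀ i : Fin n, ∃ q : β × Fin (n + 1),
      T.IsLink q.1 (w i.castSucc) (w q.2) ∧ d (w q.2) < d (w i.castSucc) := by
    intro i
    obtain ⟨e, y, he, hlt⟩ := hd _ (hwT i.castSucc) (hw.ne (Fin.castSucc_lt_last i).ne)
    obtain ⟨j, rfl⟩ : y ∈ Set.range w := hV ▸ he.right_mem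
    exact ⟨(e, j), he, hlt⟩
  choose r hrl hrd using hd'
  have hsub : Set.range (fun i => (r i).1) ⊆ T.edgeSet := by
    rintro _ ⟨i, rfl⟩
    exact (hrl i).edge_mem
  have hconn : (T.restrict (Set.range fun i => (r i).1)).IsConnected := by
    refine isConnected_of_height d (r := w (Fin.last n)) (hwT _) fun x hx hxr => ?_
    obtain ⟨i, rfl⟩ : x ∈ Set.range w := hV ▸ hx
    induction i using Fin.lastCases with
    | last => exact absurd rfl hxr
    | cast i => exact ⟨w (r i).2, ⟨_, ⟨i, rfl⟩, hrl i⟩, hrd i⟩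
  have hE : Set.range (fun i => (r i).1) = T.edgeSet := hsub.antisymm (hT.2.edgeSet_subset hconn)
  refine ⟨r, fun i => (hrl i).mono hTG.le, ⟨fun i => d (w i), hrd⟩, ?_⟩
  rw [hE]
  refine (Compatible.of_le_le (G := G) restrict_le hTG.le).ext hTG.vertexSet_eq.symm ?_
  rw [edgeSet_restrict]
  exact Set.inter_eq_right.2 hTG.le.edgeSet_mono

open scoped Classical in
/-- The edges at the `i`-th vertex, each paired with the index of its other end. -/
noncomputable def edgeChoices (G : Graph α β) (hE : G.edgeSet.Finite) (w : Fin (n + 1) → α)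
    (i : Fin n) : Finset (β × Fin (n + 1)) :=
  (hE.toFinset ×ˢ Finset.univ).filter fun q => G.IsLink q.1 (w i.castSucc) (w q.2)

lemma mem_edgeChoices {hE : G.edgeSet.Finite} {i : Fin n} {q : β × Fin (n + 1)} :
    q ∈ G.edgeChoices hE w i ↔ G.IsLink q.1 (w i.castSucc) (w q.2) := by
  simp only [edgeChoices, Finset.mem_filter, Finset.mem_product, Set.Finite.mem_toFinset,
    Finset.mem_univ, and_true, and_iff_right_iff_imp]
  exact IsLink.edge_mem

lemma injOn_fst_edgeChoices (hE : G.edgeSet.Finite) (hw : Function.Injective w) (i : Fin n) :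
    Set.InjOn Prod.fst (G.edgeChoices hE w i : Set (β × Fin (n + 1))) := by
  rintro ⟨e, j⟩ hj ⟨e', k⟩ hk rfl
  rw [Finset.mem_coe, mem_edgeChoices] at hj hk
  exact Prod.ext rfl (hw (hj.right_unique hk))

lemma card_edgeChoices (hE : G.edgeSet.Finite) (hw : Function.Injective w)
    (hV : Set.range w = G.vertexSet) (i : Fin n) :
    (G.edgeChoices hE w i).card = (G.incidenceSet (w i.castSucc)).ncard := by
  rw [← Set.ncard_coe_finset, ← (injOn_fst_edgeChoices hE hw i).ncard_image]
  congr 1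
  ext e
  constructor
  · rintro ⟨q, hq, rfl⟩
    exact (mem_edgeChoices.1 hq).inc_left
  · rintro ⟨y, hy⟩
    obtain ⟨j, rfl⟩ : y ∈ Set.range w := hV ▸ hy.right_mem
    exact ⟨(e, j), mem_edgeChoices.2 hy, rfl⟩

lemma card_filter_edgeChoices (hE : G.edgeSet.Finite) (hw : Function.Injective w) (i : Fin n)
    (j : Fin (n + 1)) :
    ((G.edgeChoices hE w i).filter fun q => q.2 = j).card =
      {e | G.IsLink e (w i.castSucc) (w j)}.ncard := by
  rw [← Set.ncard_coe_finset, ← ((injOn_fst_edgeChoices hE hw i).mono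
    (Finset.coe_subset.2 (Finset.filter_subset _ _))).ncard_image]
  congr 1
  ext e
  constructor
  · rintro ⟨q, hq, rfl⟩
    obtain ⟨hq', rfl⟩ := Finset.mem_filter.1 hq
    exact mem_edgeChoices.1 hq'
  · intro he
    exact ⟨(e, j), Finset.mem_filter.2 ⟨mem_edgeChoices.2 he, rfl⟩, rfl⟩

end EdgeChoice

/-! ### Expansion of the Kirchhoff minor and the tree count -/

lemma kirchhoffMinor_apply {G : Graph α β} [G.Loopless] (hE : G.edgeSet.Finite) {n : ℕ}
    (v : Fin (n + 1) ≃ G.vertexSet) (i k : Fin n) :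
    G.kirchhoffMinor v i k = ∑ q ∈ G.edgeChoices hE (fun i => (v i : α)) i,
      ((if i = k then 1 else 0) - (if q.2 = k.castSucc then 1 else 0)) := by
  have hw : Function.Injective fun i => (v i : α) := Subtype.val_injective.comp v.injective
  have hV : Set.range (fun i => (v i : α)) = G.vertexSet := by
    rw [← Function.comp_def, Set.range_comp, v.range_eq_univ, Set.image_univ, Subtype.range_coe]
  -- The index type `Fin (n + 1 - 1)` is `Fin n` by definition.
  have hM : G.kirchhoffMinor v i k = G.kirchhoffMatrix v i.castSucc k.castSucc := rfl
  rw [hM, Finset.sum_sub_distrib, Finset.sum_boole (s := G.edgeChoices hE _ i)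
    (p := fun q => q.2 = k.castSucc), card_filter_edgeChoices hE hw, Finset.sum_const,
    card_edgeChoices hE hw hV]
  by_cases hik : i = k
  · subst hik
    have h0 : G.loopSet (v i.castSucc) = ∅ := by
      ext e
      simp
    simp [kirchhoffMatrix, degree, h0]
  · simp [kirchhoffMatrix, adjacencyMatrix, hik]

open scoped Classical in
lemma det_kirchhoffMinor {G : Graph α β} [G.Loopless] (hE : G.edgeSet.Finite) {n : ℕ}
    (v : Fin (n + 1) ≃ G.vertexSet) :
    Matrix.det (n := Fin n) (G.kirchhoffMinor v) =
      ((Fintype.piFinset (G.edgeChoices hE fun i => (v i : α))).filter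
        fun r => Matrix.IsRooted fun i => (r i).2).card := by
  have hM : (G.kirchhoffMinor v : Matrix (Fin n) (Fin n) ℤ) =
      fun i => ∑ q ∈ G.edgeChoices hE (fun i => (v i : α)) i, fun k =>
        (if i = k then 1 else 0) - (if q.2 = k.castSucc then 1 else 0) := by
    funext i k
    rw [Finset.sum_apply, kirchhoffMinor_apply hE]
  rw [hM]
  -- Each term of the expansion is the determinant of `transitionLaplacian` for the map sending `i`
  -- to the other end of its chosen edge.
  refine (Matrix.detRowAlternating.toMultilinearMap.map_sum_finset
    (fun i (q : β × Fin (n + 1)) (k : Fin n) =>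
      ((if i = k then 1 else 0) - (if q.2 = k.castSucc then 1 else 0) : ℤ))
    (G.edgeChoices hE fun i => (v i : α))).trans ?_
  rw [← Finset.sum_boole]
  refine Finset.sum_congr rfl fun r _ => ?_
  split_ifs with h
  · exact Matrix.det_transitionLaplacian_of_isRooted h
  · exact Matrix.det_transitionLaplacian_of_not_isRooted h

open scoped Classical in
lemma numSpanningTrees_eq_card {G : Graph α β} (hE : G.edgeSet.Finite) {n : ℕ}
    {w : Fin (n + 1) → α} (hw : Function.Injective w) (hV : Set.range w = G.vertexSet) :
    G.numSpanningTrees = ((Fintype.piFinset (G.edgeChoices hE w)).filter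
      fun r => Matrix.IsRooted fun i => (r i).2).card := by
  have hmem : ∀ r, r ∈ (Fintype.piFinset (G.edgeChoices hE w)).filter
      (fun r => Matrix.IsRooted fun i => (r i).2) ↔
        G.IsEdgeChoice w r ∧ Matrix.IsRooted fun i => (r i).2 := by
    intro r
    simp only [Finset.mem_filter, Fintype.mem_piFinset, mem_edgeChoices, IsEdgeChoice]
  rw [← Set.ncard_coe_finset, numSpanningTrees,
    ← Set.InjOn.ncard_image (f := fun r : Fin n → β × Fin (n + 1) =>
      G.restrict (Set.range fun i => (r i).1))]
  · congr 1
    ext T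
    constructor
    · rintro ⟨hTG, hT⟩
      obtain ⟨r, hr, hroot, h⟩ := hT.exists_isEdgeChoice hTG hw hV
      exact ⟨r, (hmem r).2 ⟨hr, hroot⟩, h⟩
    · rintro ⟨r, hr, rfl⟩
      obtain ⟨hr, hroot⟩ := (hmem r).1 hr
      exact ⟨⟨restrict_le, rfl⟩, hr.isTree hw hV hroot⟩
  · intro r hr s hs h
    obtain ⟨hr, hrr⟩ := (hmem r).1 hr
    obtain ⟨hs, hsr⟩ := (hmem s).1 hs
    refine hr.eq_of_range_eq hw hs hrr hsr ?_
    have hsub : ∀ {r}, G.IsEdgeChoice w r → Set.range (fun i => (r i).1) ⊆ G.edgeSet := by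
      rintro r hr _ ⟨i, rfl⟩
      exact (hr i).edge_mem
    have h := congrArg Graph.edgeSet h
    dsimp only at h
    rwa [edgeSet_restrict, edgeSet_restrict, Set.inter_eq_right.2 (hsub hr),
      Set.inter_eq_right.2 (hsub hs)] at h

end Graph

theorem mainTheorem1 {α β : Type*} (G : Graph α β) [G.Loopless] (hE : G.edgeSet.Finite)
    (p : ℕ) (hp : 2 ≤ p) (v : Fin p ≃ G.vertexSet) :
    (G.numSpanningTrees : ℤ) = (G.kirchhoffMinor v).det := by
  obtain ⟨n, rfl⟩ : ∃ n, p = n + 1 := ⟨p - 1, by omega⟩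
  have hw : Function.Injective fun i => (v i : α) := Subtype.val_injective.comp v.injective
  have hV : Set.range (fun i => (v i : α)) = G.vertexSet := by
    rw [← Function.comp_def, Set.range_comp, v.range_eq_univ, Set.image_univ, Subtype.range_coe]
  rw [Graph.numSpanningTrees_eq_card hE hw hV]
  exact (Graph.det_kirchhoffMinor hE v).symm
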